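/- Setting. There are $m$ items and $n$ bidders. A valuation is a function $v:2^{[m]}\to[0,\infty)$ with $v(\emptyset)=0$ and $v(S)\le v(T)$ whenever $S\subseteq T$; it is (0/1) multi-minded if it takes values in $\{0,1\}$. For $d\ge 1$, a $d$-duplicate allocation is a tuple $(S_1,\dots,S_n)$ of subsets of $[m]$ such that every item lies in at most $d$ of them; a $1$-duplicate allocation (pairwise disjoint sets) is simply called an allocation. The social welfare of $(S_i)_i$ under $v_1,\dots,v_n$ is $\sum_i v_i(S_i)$. A mechanism is a deterministic communication protocol: bidder $i$ holds $v_i$; in each round an arbitrary yes/no question about a single $v_i$, which may depend on all earlier answers, is put to bidder $i$, whose answer costs one bit; at the end the protocol outputs a tuple of bundles and a vector of nonnegative prices. Its communication on $(v_1,\dots,v_n)$ is the number of bits transmitted. A mechanism for auctions with $d$ duplicates is VCG-based (maximal-in-range) if there is a fixed set $\mathcal H$ of $d$-duplicate allocations such that on every input $(v_1,\dots,v_n)$ its output is an element of $\mathcal H$ that maximizes the social welfare over $\mathcal H$. It has approximation ratio $\alpha$ with respect to multi-minded valuations if for all multi-minded $v_1,\dots,v_n$ and every allocation $(S_i)_i$,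 the social welfare of its output is at least $\frac1\alpha\sum_i v_i(S_i)$ (in particular this holds if its output is within a factor $\alpha$ of the best $d$-duplicate allocation). Theorem. For every integer $d\ge1$ and every real $\varepsilon>0$ there is $m_0=m_0(d,\varepsilon)$ such that for all $m\ge m_0$ and all $n\ge m^{1-3\varepsilon/4}$ the following holds. Every VCG-based mechanism for combinatorial auctions with $d$ duplicates, $m$ items and $n$ bidders with multi-minded valuations that has approximation ratio $m^{1-\varepsilon}$ with respect to multi-minded valuations transmits, for some multi-minded $v_1,\dots,v_n$, at least $\exp\!\left(m^{\varepsilon/2}\right)$ bits. -/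

import Mathlib

open scoped NNReal

namespace CombAuction

/-- A valuation over bundles of `m` items: normalized and nondecreasing
(and hence nonnegative). -/
structure Valuation (m : ℕ) where
  toFun : Finset (Fin m) → ℝ
  map_empty' : toFun ∅ = 0
  mono' : Monotone toFun

instance (m : ℕ) : CoeFun (Valuation m) (fun _ => Finset (Fin m) → ℝ) := ⟨Valuation.toFun⟩

/-- The class of (0/1) multi-minded valuations: all valuations with values in `{0, 1}`. -/
def MultiMinded (m : ℕ) : Set (Valuation m) := {v | ∀ S, v S = 0 ∨ v S = 1}

/-- A collection of `n` bundles of the `m` items, bidder `i` receiving the bundle `S i`. -/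
abbrev Bundles (n m : ℕ) : Type := Fin n → Finset (Fin m)

/-- An allocation: the bundles are pairwise disjoint. -/
def IsAllocation {n m : ℕ} (S : Bundles n m) : Prop :=
  ∀ i j, i ≠ j → Disjoint (S i) (S j)

/-- A `d`-duplicate allocation: every item belongs to at most `d` of the bundles. -/
def IsDuplicateAllocation {n m : ℕ} (d : ℕ) (S : Bundles n m) : Prop :=
  ∀ x : Fin m, (Finset.univ.filter fun i => x ∈ S i).card ≤ d

/-- The social welfare `∑ i, v i (S i)`. -/
def welfare {n m : ℕ} (v : Fin n → Valuation m) (S : Bundles n m) : ℝ := ∑ i, v i (S i)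

/-- A deterministic communication protocol among parties indexed by `ι`, each holding a private
input in `V`. In every round an arbitrary one-bit question is put to one party, which answers
according to its own input alone; the party and the question may depend on all previous answers.
(A question with an `ℓ`-bit answer is `ℓ` one-bit questions.) -/
inductive Protocol (ι V Out : Type) : Type
  | output (o : Out) : Protocol ι V Out
  | ask (i : ι) (q : V → Bool) (next : Bool → Protocol ι V Out) : Protocol ι V Out

namespace Protocol

variable {ι V Out : Type}

/-- The output of the protocol on the inputs `v`. -/
def result : Protocol ι V Out → (ι → V) → Out
  | output o, _ => o
  | ask i q next, v => (next (q (v i))).result v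

/-- The number of bits transmitted by the parties when the protocol runs on the inputs `v`. -/
def bits : Protocol ι V Out → (ι → V) → ℕ
  | output _, _ => 0
  | ask i q next, v => (next (q (v i))).bits v + 1

end Protocol

/-- A mechanism for `n` bidders with valuations from the class `F`, in the communication model:
a protocol among the bidders, whose output is a bundle and a price for each bidder. -/
abbrev Mechanism (n m : ℕ) (F : Set (Valuation m)) : Type :=
  Protocol (Fin n) F (Bundles n m × (Fin n → ℝ≥0))

namespace Mechanism

variable {n m : ℕ} {F : Set (Valuation m)}

/-- The bundles that the mechanism allocates on the valuations `v`. -/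
def bundles (M : Mechanism n m F) (v : Fin n → F) : Bundles n m := (M.result v).1

/-- `M` is VCG-based, or maximal-in-range, for auctions with `d` copies of each item: there is a
fixed bank `H` of `d`-duplicate allocations, and on all valuations the output of `M` is an element
of `H` whose social welfare is maximal in `H`. -/
def IsVCGBased (d : ℕ) (M : Mechanism n m F) : Prop :=
  ∃ H : Set (Bundles n m), (∀ S ∈ H, IsDuplicateAllocation d S) ∧
    ∀ v : Fin n → F, M.bundles v ∈ H ∧
      ∀ S ∈ H, welfare (fun i => (v i : Valuation m)) S ≤
        welfare (fun i => (v i : Valuation m)) (M.bundles v)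

/-- `M` has approximation ratio `α` with respect to `F`: on all valuations from `F`, the social
welfare of the output is at least `1 / α` times that of every allocation of the items. (Measuring
against `d`-duplicate allocations as well would be a stronger requirement.) -/
def HasApproxRatio (M : Mechanism n m F) (α : ℝ) : Prop :=
  ∀ (v : Fin n → F) (S : Bundles n m), IsAllocation S →
    1 / α * welfare (fun i => (v i : Valuation m)) S ≤
      welfare (fun i => (v i : Valuation m)) (M.bundles v)

end Mechanism

end CombAuction

/-
A maximal-in-range mechanism with a good approximation ratio has a bank that is rich on many items:
there are `d + 1` bidders among whom the items of a large set can be split arbitrarily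
(`exists_spreads_zero`). As long as few bits are transmitted, one bidder after the other can be given
the whole of a set that shrinks only by a constant factor (`Spreads.exists_succ`): otherwise the
bank contains no combination of the bundles of a random family of splits, and that family yields a
fooling set (`IsMaximalIn.exists_le_bits`). In the end all `d + 1` bidders get the same items, which
no `d`-duplicate allocation allows.
-/

/-! Two principles drive the bound. A Sauer–Shelah-type count: if every function on a set is
assigned one of few witnesses `u`, then the functions assigned some single `u` realise all patterns
on a constant fraction of the set (`exists_shatter_of_forall_exists`). And the rectangle property:
two inputs with the same transcript can be mixed bidder by bidder without changing the output.
Bidders wanting the pieces of a partition make the approximation ratio force `d + 1` satisfied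
bidders; the count fixes who they are. To promote bidder `e`, take `2 * N` arbitrary colourings of
the current set. Cheap communication forces the bank to serve bidder `e` according to one colouring
and the others according to different ones. Decoupled in this way, the colouring of `e` can be
constant while the others still realise every split on a smaller set (`Spreads.exists_succ`). -/

namespace CombAuction

/-! ### Shattering with label sets of positive density -/

/-- A family of functions `Fin n → Λ` that shatters only sets of size at most `s`, with respect to
label sets `B j` of density at least `p`, is small. -/
theorem card_le_of_forall_shatter_fin {ι Λ : Type*} [Fintype Λ] (B : ι → Finset Λ) {p : ℝ}
    (hp0 : 0 ≤ p) (hp1 : p ≤ 1) (hB : ∀ j, p * Fintype.card Λ ≤ (B j).card) (n : ℕ) :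
    ∀ (s : ℕ) (F : Finset (Fin n → Λ)),
      (∀ T : Finset (Fin n), (∀ g : Fin n → ι, ∃ f ∈ F, ∀ x ∈ T, f x ∈ B (g x)) → T.card ≤ s) →
      (F.card : ℝ) ≤ 2 ^ s * ((1 - p / 2) * Fintype.card Λ) ^ n := by
  classical
  induction n with
  | zero =>
    intro s F _
    have h1 : F.card ≤ 1 := Finset.card_le_one.2 fun a _ b _ => Subsingleton.elim a b
    have h2 : (F.card : ℝ) ≤ 1 := by exact_mod_cast h1
    have h3 : (1 : ℝ) ≤ 2 ^ s := one_le_pow₀ (by norm_num)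
    simpa using h2.trans h3
  | succ n ih =>
    intro s F hs
    set q : ℝ := (Fintype.card Λ : ℝ) with hq
    have hq0 : 0 ≤ q := Nat.cast_nonneg _
    -- Sauer–Shelah induction: `I` collects the tails whose fibre meets every `B j`. Other fibres
    -- miss some `B j`, so have at most `(1 - p) * q` elements. Coordinate `0` can be added to any
    -- set shattered by `I`, so `I` has parameter `s - 1`, which halves its bound and yields the
    -- factor `1 - p + p / 2`.
    set U : Finset (Fin n → Λ) := F.image Fin.tail with hU
    set I : Finset (Fin n → Λ) :=
      U.filter fun g => ∀ j, ∃ l ∈ B j, (Fin.cons l g : Fin (n + 1) → Λ) ∈ F with hI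
    have hfib : ∀ g ∈ U, (((F.filter fun f => Fin.tail f = g).card : ℕ) : ℝ) ≤
        (1 - p) * q + (if g ∈ I then p * q else 0) := by
      intro g hg
      set E := (F.filter fun f => Fin.tail f = g).image (fun f => f 0) with hE
      have hcard : (F.filter fun f => Fin.tail f = g).card = E.card := by
        rw [hE, Finset.card_image_of_injOn]
        intro f hf f' hf' h
        have h1 := (Finset.mem_filter.1 hf).2
        have h2 := (Finset.mem_filter.1 hf').2
        rw [← Fin.cons_self_tail f, ← Fin.cons_self_tail f', h1, h2]
        exact congrArg (fun l => (Fin.cons l g : Fin (n + 1) → Λ)) h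
      rw [hcard]
      split_ifs with hgI
      · have : (E.card : ℝ) ≤ q := Nat.cast_le.2 (Finset.card_le_univ E)
        linarith
      · have : ∃ j, ∀ l ∈ B j, (Fin.cons l g : Fin (n + 1) → Λ) ∉ F := by
          by_contra! h
          exact hgI (Finset.mem_filter.2 ⟨hg, h⟩)
        obtain ⟨j, hj⟩ := this
        have hdis : Disjoint E (B j) := by
          rw [Finset.disjoint_left]
          intro l hl hlB
          obtain ⟨f, hf, rfl⟩ := Finset.mem_image.1 hl
          obtain ⟨hfF, rfl⟩ := Finset.mem_filter.1 hf
          exact hj _ hlB (by rwa [Fin.cons_self_tail])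
        have h1 : E.card + (B j).card ≤ Fintype.card Λ := by
          rw [← Finset.card_union_of_disjoint hdis]
          exact Finset.card_le_univ _
        have h2 : (E.card : ℝ) + (B j).card ≤ q := by
          rw [hq]
          exact_mod_cast h1
        have h3 := hB j
        linarith
    have hsum : (F.card : ℝ) ≤ (1 - p) * q * U.card + p * q * I.card := by
      have h1 : F.card = ∑ g ∈ U, (F.filter fun f => Fin.tail f = g).card :=
        Finset.card_eq_sum_card_fiberwise fun f hf => Finset.mem_image_of_mem _ hf
      rw [h1, Nat.cast_sum]
      refine (Finset.sum_le_sum hfib).trans (le_of_eq ?_)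
      rw [Finset.sum_add_distrib, Finset.sum_const, Finset.sum_ite_mem,
        Finset.inter_eq_right.2 (Finset.filter_subset _ _), Finset.sum_const]
      simp only [nsmul_eq_mul]
      ring
    have hUb : (U.card : ℝ) ≤ 2 ^ s * ((1 - p / 2) * q) ^ n := by
      refine ih s U fun T hT => ?_
      have := hs (T.map (Fin.succEmb n)) fun g => by
        obtain ⟨f, hf, hfT⟩ := hT fun x => g x.succ
        obtain ⟨f', hf', rfl⟩ := Finset.mem_image.1 hf
        refine ⟨f', hf', fun x hx => ?_⟩
        obtain ⟨y, hy, rfl⟩ := Finset.mem_map.1 hx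
        exact hfT y hy
      simpa using this
    have hIs : ∀ T : Finset (Fin n), (∀ g : Fin n → ι, ∃ f ∈ I, ∀ x ∈ T, f x ∈ B (g x)) →
        T.card + 1 ≤ s := by
      intro T hT
      have h0 : (0 : Fin (n + 1)) ∉ T.map (Fin.succEmb n) := by simp
      have := hs (insert 0 (T.map (Fin.succEmb n))) fun g => by
        obtain ⟨f, hf, hfT⟩ := hT fun x => g x.succ
        obtain ⟨l, hl, hlF⟩ := (Finset.mem_filter.1 hf).2 (g 0)
        refine ⟨_, hlF, fun x hx => ?_⟩
        rcases Finset.mem_insert.1 hx with rfl | hx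
        · simpa using hl
        · obtain ⟨y, hy, rfl⟩ := Finset.mem_map.1 hx
          simpa using hfT y hy
      simpa [Finset.card_insert_of_notMem h0] using this
    have hIb : (I.card : ℝ) ≤ 2 ^ s / 2 * ((1 - p / 2) * q) ^ n := by
      cases s with
      | zero =>
        -- A member of `I` would make `{0}` shattered, against `s = 0`.
        have : I = ∅ := by
          by_contra h
          obtain ⟨f, hf⟩ := Finset.nonempty_iff_ne_empty.2 h
          have := hIs ∅ fun g => ⟨f, hf, by simp⟩
          omega
        rw [this, Finset.card_empty, Nat.cast_zero]
        have : 0 ≤ 1 - p / 2 := by linarith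
        positivity
      | succ s =>
        have := ih s I fun T hT => Nat.le_of_succ_le_succ (hIs T hT)
        rwa [pow_succ, mul_div_cancel_right₀ _ (two_ne_zero)]
    have h1 : 0 ≤ (1 - p) * q := mul_nonneg (by linarith) hq0
    have h2 : 0 ≤ p * q := mul_nonneg hp0 hq0
    calc (F.card : ℝ) ≤ (1 - p) * q * U.card + p * q * I.card := hsum
      _ ≤ (1 - p) * q * (2 ^ s * ((1 - p / 2) * q) ^ n) +
          p * q * (2 ^ s / 2 * ((1 - p / 2) * q) ^ n) := by gcongr
      _ = 2 ^ s * ((1 - p / 2) * q) ^ (n + 1) := by ring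

/-- If each function `f : α → Λ` is related to some `u : V`, then the functions related to a suitable
`u` shatter a set containing a constant fraction of `α`. -/
theorem exists_shatter_of_forall_exists {ι Λ V α : Type*} [Fintype Λ] [Nonempty Λ] [Fintype V]
    [Fintype α] (B : V → ι → Finset Λ) {p : ℝ} (hp0 : 0 ≤ p) (hp1 : p ≤ 1)
    (R : (α → Λ) → V → Prop) (hR : ∀ f, ∃ u, R f u)
    (hB : ∀ f u, R f u → ∀ j, p * Fintype.card Λ ≤ (B u j).card)
    (hV : Real.log (Fintype.card V) < p * Fintype.card α / 4) :
    ∃ (u : V) (T : Finset α), p * Fintype.card α / 4 ≤ T.card ∧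
      ∀ g : α → ι, ∃ f, R f u ∧ ∀ x ∈ T, f x ∈ B u (g x) := by
  classical
  set n := Fintype.card α with hn
  set q := Fintype.card Λ with hq
  have hq0 : (0 : ℝ) < q := by exact_mod_cast Fintype.card_pos
  let e : α ≃ Fin n := Fintype.equivFin α
  let F : V → Finset (Fin n → Λ) := fun u => Finset.univ.filter fun f => R (f ∘ e) u
  by_contra! hcon
  -- The threshold balances a union bound: `|V| < exp y`, `2 ^ ⌊y⌋ ≤ exp y` and `(1 - p / 2) ^ n ≤
  -- exp (-2y)`, so classes that shatter only smaller sets cannot cover all functions.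
  set y : ℝ := p * n / 4 with hy
  have hy0 : 0 ≤ y := by positivity
  have hcard : ∀ u, ((F u).card : ℝ) ≤ 2 ^ ⌊y⌋₊ * ((1 - p / 2) * q) ^ n := by
    intro u
    by_cases hu : ∃ f, R f u
    · obtain ⟨f₀, hf₀⟩ := hu
      refine card_le_of_forall_shatter_fin (B u) hp0 hp1 (hB f₀ u hf₀) n _ (F u) fun T hT => ?_
      by_contra! hlt
      have hlt' : y < T.card := (Nat.floor_lt hy0).1 hlt
      obtain ⟨g, hg⟩ := hcon u (T.map e.symm.toEmbedding) (by simpa using hlt'.le)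
      obtain ⟨f, hf, hfT⟩ := hT (g ∘ e.symm)
      obtain ⟨x, hx, hxB⟩ := hg (f ∘ e) (Finset.mem_filter.1 hf).2
      obtain ⟨z, hz, rfl⟩ := Finset.mem_map.1 hx
      exact hxB (by simpa using hfT z hz)
    · have : F u = ∅ := Finset.filter_eq_empty_iff.2 fun f _ hf => hu ⟨_, hf⟩
      rw [this, Finset.card_empty, Nat.cast_zero]
      have : 0 ≤ 1 - p / 2 := by linarith
      positivity
  have htotal : (q : ℝ) ^ n ≤ Fintype.card V * (2 ^ ⌊y⌋₊ * ((1 - p / 2) * q) ^ n) := by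
    have h1 : (Finset.univ : Finset (Fin n → Λ)) ⊆ Finset.univ.biUnion F := by
      intro f _
      obtain ⟨u, hu⟩ := hR (f ∘ e)
      exact Finset.mem_biUnion.2 ⟨u, Finset.mem_univ _, Finset.mem_filter.2 ⟨Finset.mem_univ _, hu⟩⟩
    have h2 := (Finset.card_le_card h1).trans Finset.card_biUnion_le
    rw [Finset.card_univ, Fintype.card_fun, Fintype.card_fin] at h2
    have h3 : (q : ℝ) ^ n ≤ ∑ u, ((F u).card : ℝ) := by exact_mod_cast h2
    refine h3.trans ((Finset.sum_le_sum fun u _ => hcard u).trans (le_of_eq ?_))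
    rw [Finset.sum_const, nsmul_eq_mul, Finset.card_univ]
  have hVpos : (0 : ℝ) < Fintype.card V := by
    obtain ⟨u, _⟩ := hR fun _ => Classical.arbitrary Λ
    exact_mod_cast Fintype.card_pos_iff.2 ⟨u⟩
  have hVe : (Fintype.card V : ℝ) < Real.exp y := (Real.log_lt_iff_lt_exp hVpos).1 hV
  have h2e : (2 : ℝ) ^ ⌊y⌋₊ ≤ Real.exp y := by
    have h1 : (2 : ℝ) ≤ Real.exp 1 := by
      have := Real.add_one_le_exp (1 : ℝ)
      linarith
    calc (2 : ℝ) ^ ⌊y⌋₊ ≤ Real.exp 1 ^ ⌊y⌋₊ := by gcongr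
      _ = Real.exp ⌊y⌋₊ := by rw [← Real.exp_nat_mul, mul_one]
      _ ≤ Real.exp y := Real.exp_le_exp.2 (Nat.floor_le hy0)
  have hpe : (1 - p / 2) ^ n ≤ Real.exp (-(2 * y)) := by
    have h1 : 1 - p / 2 ≤ Real.exp (-(p / 2)) := by
      have := Real.add_one_le_exp (-(p / 2))
      linarith
    calc (1 - p / 2) ^ n ≤ Real.exp (-(p / 2)) ^ n := pow_le_pow_left₀ (by linarith) h1 n
      _ = Real.exp (-(2 * y)) := by
        rw [← Real.exp_nat_mul, hy]
        congr 1
        ring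
  have hlt : (Fintype.card V : ℝ) * (2 ^ ⌊y⌋₊ * ((1 - p / 2) * q) ^ n) < (q : ℝ) ^ n := by
    have hqn : (0 : ℝ) < (q : ℝ) ^ n := by positivity
    have hpn : 0 ≤ (1 - p / 2) ^ n := pow_nonneg (by linarith) n
    calc (Fintype.card V : ℝ) * (2 ^ ⌊y⌋₊ * ((1 - p / 2) * q) ^ n)
        = Fintype.card V * (2 ^ ⌊y⌋₊ * (1 - p / 2) ^ n) * q ^ n := by rw [mul_pow]; ring
      _ ≤ Fintype.card V * (Real.exp y * Real.exp (-(2 * y))) * q ^ n := by gcongr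
      _ < Real.exp y * (Real.exp y * Real.exp (-(2 * y))) * q ^ n := by gcongr
      _ = (q : ℝ) ^ n := by
        rw [← Real.exp_add, ← Real.exp_add]
        ring_nf
        simp
  exact absurd htotal (not_le.2 hlt)

/-! ### The rectangle property of transcripts -/

namespace Protocol

variable {ι V Out : Type}

/-- Among more than `2 ^ c` inputs on each of which at most `c` bits are transmitted, two lead to
the same transcript, and so does every input composed of these two. -/
theorem exists_ne_forall_mix_result_eq {κ : Type*} (x : κ → ι → V) (P : Protocol ι V Out) :
    ∀ (c : ℕ) (A : Finset κ), (∀ a ∈ A, P.bits (x a) ≤ c) → 2 ^ c < A.card →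
      ∃ a ∈ A, ∃ a' ∈ A, a ≠ a' ∧ ∃ o, ∀ z : ι → V, (∀ i, z i = x a i ∨ z i = x a' i) →
        P.result z = o := by
  classical
  induction P with
  | output o =>
    intro c A _ hA
    obtain ⟨a, ha, a', ha', hne⟩ := Finset.one_lt_card.1 (lt_of_le_of_lt Nat.one_le_two_pow hA)
    exact ⟨a, ha, a', ha', hne, o, fun z _ => rfl⟩
  | ask i q next ih =>
    intro c A hbits hA
    obtain ⟨a₀, ha₀⟩ := Finset.card_pos.1 (lt_of_le_of_lt (Nat.zero_le _) hA)
    obtain ⟨c, rfl⟩ : ∃ c', c = c' + 1 :=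
      ⟨c - 1, by have := hbits a₀ ha₀; simp only [bits] at this; omega⟩
    -- One bit halves the family at worst; the mixed inputs give the same answer because party `i`
    -- holds one of two inputs with answer `r`.
    have hsplit : ∃ r : Bool, 2 ^ c < (A.filter fun a => q (x a i) = r).card := by
      by_contra! h
      have h1 := h true
      have h2 := h false
      have h3 := Finset.card_filter_add_card_filter_not (s := A) fun a => q (x a i) = true
      simp only [Bool.not_eq_true] at h3
      rw [pow_succ] at hA
      omega
    obtain ⟨r, hr⟩ := hsplit
    obtain ⟨a, ha, a', ha', hne, o, ho⟩ := ih r c _ (fun a ha => by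
      obtain ⟨haA, har⟩ := Finset.mem_filter.1 ha
      have := hbits a haA
      simp only [bits, har] at this
      omega) hr
    obtain ⟨haA, har⟩ := Finset.mem_filter.1 ha
    obtain ⟨haA', har'⟩ := Finset.mem_filter.1 ha'
    refine ⟨a, haA, a', haA', hne, o, fun z hz => ?_⟩
    have hzr : q (z i) = r := by rcases hz i with h | h <;> rw [h] <;> assumption
    simp only [result, hzr]
    exact ho z hz

end Protocol

/-! ### Multi-minded bids and the fooling set -/

variable {n m k : ℕ}

open Classical in
/-- The multi-minded bidder who wants a nonempty bundle that contains a member of `𝒜`. -/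
noncomputable def wants (𝒜 : Set (Finset (Fin m))) : MultiMinded m where
  val :=
    -- Nonemptiness keeps the value of `∅` at `0` even when `∅ ∈ 𝒜`, as happens for a colour class
    -- without items.
    { toFun := fun S => if S.Nonempty ∧ ∃ A ∈ 𝒜, A ⊆ S then 1 else 0
      map_empty' := by simp
      mono' := by
        intro S T hST
        dsimp only
        split_ifs with h1 h2
        · exact le_rfl
        · obtain ⟨hS, A, hA, hAS⟩ := h1
          exact absurd ⟨hS.mono hST, A, hA, hAS.trans hST⟩ h2
        · exact zero_le_one
        · exact le_rfl }
  property := by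
    intro S
    dsimp only
    split_ifs
    · exact Or.inr rfl
    · exact Or.inl rfl

theorem wants_eq_one_iff {𝒜 : Set (Finset (Fin m))} {S : Finset (Fin m)} :
    (wants 𝒜 : Valuation m) S = 1 ↔ S.Nonempty ∧ ∃ A ∈ 𝒜, A ⊆ S := by
  simp [wants]

theorem wants_empty (S : Finset (Fin m)) : ((wants ∅ : MultiMinded m) : Valuation m) S = 0 := by
  simp [wants]

theorem MultiMinded.le_one (v : MultiMinded m) (S : Finset (Fin m)) : (v : Valuation m) S ≤ 1 := by
  rcases v.2 S with h | h <;> rw [h]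
  exact zero_le_one

/-- The valuations in which bidder `b j` wants a member of `𝒜 j`, and the bidders outside the range
of `b` want nothing. -/
noncomputable def bids (b : Fin k → Fin n) (𝒜 : Fin k → Set (Finset (Fin m))) :
    Fin n → MultiMinded m :=
  fun i => wants {A | ∃ j, b j = i ∧ A ∈ 𝒜 j}

theorem bids_apply {b : Fin k → Fin n} (hb : Function.Injective b)
    (𝒜 : Fin k → Set (Finset (Fin m))) (j : Fin k) : bids b 𝒜 (b j) = wants (𝒜 j) := by
  unfold bids
  congr 1
  ext A
  constructor
  · rintro ⟨j', h, hA⟩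
    rwa [← hb h]
  · exact fun hA => ⟨j, rfl, hA⟩

theorem bids_of_notMem (b : Fin k → Fin n) (𝒜 : Fin k → Set (Finset (Fin m))) {i : Fin n}
    (hi : ∀ j, b j ≠ i) : bids b 𝒜 i = wants ∅ := by
  unfold bids
  congr 1
  ext A
  simp [hi]

theorem welfare_bids {b : Fin k → Fin n} (hb : Function.Injective b)
    (𝒜 : Fin k → Set (Finset (Fin m))) (S : Bundles n m) :
    welfare (fun i => (bids b 𝒜 i : Valuation m)) S =
      ∑ j, (wants (𝒜 j) : Valuation m) (S (b j)) := by
  classical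
  unfold welfare
  rw [← Finset.sum_subset (Finset.subset_univ (Finset.univ.map ⟨b, hb⟩))]
  · rw [Finset.sum_map]
    exact Finset.sum_congr rfl fun j _ => by
      dsimp only [Function.Embedding.coeFn_mk]
      rw [bids_apply hb]
  · intro i _ hi
    dsimp only
    rw [bids_of_notMem b 𝒜 (fun j hj => hi (Finset.mem_map.2 ⟨j, Finset.mem_univ _, hj⟩)),
      wants_empty]

/-- The bundles `S` give each bidder `b j` a nonempty bundle that contains a member of `𝒜 j`. -/
def Satisfies (b : Fin k → Fin n) (𝒜 : Fin k → Set (Finset (Fin m))) (S : Bundles n m) : Prop :=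
  ∀ j, (S (b j)).Nonempty ∧ ∃ A ∈ 𝒜 j, A ⊆ S (b j)

/-- Each of the `k` active bidders contributes at most `1`, so welfare `k` leaves nobody
unsatisfied. -/
theorem satisfies_iff_le_welfare {b : Fin k → Fin n} (hb : Function.Injective b)
    (𝒜 : Fin k → Set (Finset (Fin m))) (S : Bundles n m) :
    Satisfies b 𝒜 S ↔ (k : ℝ) ≤ welfare (fun i => (bids b 𝒜 i : Valuation m)) S := by
  have hk : (k : ℝ) = ∑ _j : Fin k, (1 : ℝ) := by simp
  rw [welfare_bids hb]
  constructor
  · intro h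
    rw [hk]
    exact Finset.sum_le_sum fun j _ => (wants_eq_one_iff.2 (h j)).ge
  · intro h j
    have hle : ∀ j ∈ Finset.univ, (wants (𝒜 j) : Valuation m) (S (b j)) ≤ 1 :=
      fun j _ => MultiMinded.le_one _ _
    have heq := (Finset.sum_eq_sum_iff_of_le hle).1
      (le_antisymm (Finset.sum_le_sum hle) (hk ▸ h))
    exact wants_eq_one_iff.1 (heq j (Finset.mem_univ j))

/-- `M` outputs a welfare maximizer over the bank `H`. -/
def IsMaximalIn (M : Mechanism n m (MultiMinded m)) (H : Set (Bundles n m)) : Prop :=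
  ∀ v : Fin n → MultiMinded m, M.bundles v ∈ H ∧
    ∀ S ∈ H, welfare (fun i => (v i : Valuation m)) S ≤
      welfare (fun i => (v i : Valuation m)) (M.bundles v)

theorem IsMaximalIn.satisfies {M : Mechanism n m (MultiMinded m)} {H : Set (Bundles n m)}
    (hM : IsMaximalIn M H) {b : Fin k → Fin n} (hb : Function.Injective b)
    {𝒜 : Fin k → Set (Finset (Fin m))} (h : ∃ S ∈ H, Satisfies b 𝒜 S) :
    Satisfies b 𝒜 (M.bundles (bids b 𝒜)) := by
  obtain ⟨S, hS, hsat⟩ := h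
  rw [satisfies_iff_le_welfare hb] at hsat ⊢
  exact hsat.trans ((hM _).2 S hS)

/-- A fooling set of `2 ^ N` inputs, none of which can be satisfied within the bank, while each input
that takes bidder `b e` from one and the other bidders from another can, forces `N` bits. -/
theorem IsMaximalIn.exists_le_bits {M : Mechanism n m (MultiMinded m)} {H : Set (Bundles n m)}
    (hM : IsMaximalIn M H) {b : Fin k → Fin n} (hb : Function.Injective b) (e : Fin k) (N : ℕ)
    (𝒜 : (Fin N → Bool) → Fin k → Set (Finset (Fin m)))
    (hno : ∀ c, ∀ S ∈ H, ¬ Satisfies b (𝒜 c) S)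
    (hyes : ∀ c c', c ≠ c' → ∃ S ∈ H, Satisfies b (Function.update (𝒜 c') e (𝒜 c e)) S) :
    ∃ v, N ≤ M.bits v := by
  classical
  by_contra! hlt
  have hN : 0 < N := lt_of_le_of_lt (Nat.zero_le _) (hlt fun _ => wants ∅)
  obtain ⟨c, -, c', -, hne, o, ho⟩ :=
    Protocol.exists_ne_forall_mix_result_eq (fun c => bids b (𝒜 c)) M (N - 1) Finset.univ
      (fun c _ => Nat.le_sub_one_of_lt (hlt _)) (by
        rw [Finset.card_univ, Fintype.card_fun, Fintype.card_fin, Fintype.card_bool]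
        exact Nat.pow_lt_pow_right (by norm_num) (by omega))
  have hmix : ∀ 𝒞 : Fin k → Set (Finset (Fin m)), (∀ j, 𝒞 j = 𝒜 c j ∨ 𝒞 j = 𝒜 c' j) →
      M.bundles (bids b 𝒞) = o.1 := by
    intro 𝒞 h𝒞
    unfold Mechanism.bundles
    rw [ho]
    intro i
    by_cases hi : ∃ j, b j = i
    · obtain ⟨j, rfl⟩ := hi
      simp only [bids_apply hb]
      exact (h𝒞 j).imp (congrArg wants) (congrArg wants)
    · left
      push Not at hi
      simp only [bids_of_notMem b _ hi]
  -- Both mixtures yield the same `o`. One shows that `o` satisfies bidder `b e` of `c`, the other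
  -- that it satisfies the remaining bidders of `c`; together they contradict `hno c`.
  have key : ∀ a a', (a = c ∧ a' = c' ∨ a = c' ∧ a' = c) →
      Satisfies b (Function.update (𝒜 a') e (𝒜 a e)) o.1 := by
    intro a a' h
    rw [← hmix (Function.update (𝒜 a') e (𝒜 a e))]
    · exact hM.satisfies hb (hyes a a' (by rcases h with ⟨rfl, rfl⟩ | ⟨rfl, rfl⟩ <;> tauto))
    · intro j
      by_cases hj : j = e
      · subst hj
        rw [Function.update_self]
        rcases h with ⟨rfl, rfl⟩ | ⟨rfl, rfl⟩ <;> simp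
      · rw [Function.update_of_ne hj]
        rcases h with ⟨rfl, rfl⟩ | ⟨rfl, rfl⟩ <;> simp
  have ho : o.1 ∈ H := by
    rw [← hmix (𝒜 c) fun j => Or.inl rfl]
    exact (hM _).1
  refine hno c _ ho fun j => ?_
  by_cases hj : j = e
  · subst hj
    simpa using key c c' (by tauto) j
  · simpa [hj] using key c' c (by tauto) j

/-! ### Promoting bidders to the whole set -/

/-- For every colouring `g` of the items, the bank `H` has a member that gives all of `T` to the
bidders `b j` with `j < e`, gives every other bidder `b j` the items of `T` of colour `j`, and leaves
no bidder `b j` without items. -/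
def Spreads (H : Set (Bundles n m)) (b : Fin k → Fin n) (e : ℕ) (T : Finset (Fin m)) : Prop :=
  ∀ g : Fin m → Fin k, ∃ S ∈ H, ∀ j, (S (b j)).Nonempty ∧
    ∀ x ∈ T, ((j : ℕ) < e ∨ g x = j) → x ∈ S (b j)

theorem Spreads.eq_empty {H : Set (Bundles n m)} {d : ℕ}
    (hH : ∀ S ∈ H, IsDuplicateAllocation d S) (hk : d < k) {b : Fin k → Fin n}
    (hb : Function.Injective b) {T : Finset (Fin m)} (hT : Spreads H b k T) : T = ∅ := by
  by_contra h
  obtain ⟨x, hx⟩ := Finset.nonempty_iff_ne_empty.2 h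
  obtain ⟨S, hS, hmem⟩ := hT fun _ => ⟨0, by omega⟩
  have hsub : Finset.univ.map ⟨b, hb⟩ ⊆ Finset.univ.filter fun i => x ∈ S i := by
    intro i hi
    obtain ⟨j, -, rfl⟩ := Finset.mem_map.1 hi
    exact Finset.mem_filter.2 ⟨Finset.mem_univ _, (hmem j).2 x hx (Or.inl j.2)⟩
  have h1 := Finset.card_le_card hsub
  rw [Finset.card_map, Finset.card_univ, Fintype.card_fin] at h1
  have h2 := hH S hS x
  omega

/-- Overwriting `l` at the points `u i` by the prescribed values loses only `l ∘ u`, which has `k ^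
k` possibilities. The prescription is consistent because `u e` differs from the other points. -/
theorem card_le_card_filter_mul_pow {U : Type*} [Fintype U] [DecidableEq U] (u : Fin k → U)
    (e j : Fin k) (hu : ∀ i, i ≠ e → u i ≠ u e) :
    Fintype.card (U → Fin k) ≤
      (Finset.univ.filter fun l : U → Fin k => l (u e) = e ∧ ∀ i, i ≠ e → l (u i) = j).card *
        k ^ k := by
  classical
  let ov : (U → Fin k) → U → Fin k :=
    fun l w => if w = u e then e else if ∃ i, u i = w then j else l w
  have hcard : (Finset.univ : Finset (Fin k → Fin k)).card = k ^ k := by simp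
  rw [← hcard, ← Finset.card_product, ← Finset.card_univ]
  refine Finset.card_le_card_of_injOn (fun l => (ov l, l ∘ u)) ?_ ?_
  · intro l _
    simp only [Finset.coe_product, Set.mem_prod, Finset.mem_coe, Finset.mem_filter,
      Finset.mem_univ, true_and, and_true]
    refine ⟨if_pos rfl, fun i hi => ?_⟩
    simp only [ov]
    rw [if_neg (hu i hi), if_pos ⟨i, rfl⟩]
  · intro l _ l' _ h
    obtain ⟨h1, h2⟩ := Prod.mk.inj h
    funext w
    by_cases hw : ∃ i, u i = w
    · obtain ⟨i, rfl⟩ := hw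
      exact congrFun h2 i
    · have h3 := congrFun h1 w
      have hwe : w ≠ u e := fun h => hw ⟨e, h.symm⟩
      simpa only [ov, if_neg hwe, if_neg hw] using h3

theorem Spreads.exists_succ {M : Mechanism n m (MultiMinded m)} {H : Set (Bundles n m)}
    (hM : IsMaximalIn M H) {b : Fin k → Fin n} (hb : Function.Injective b) {e : Fin k}
    {T : Finset (Fin m)} (hT : Spreads H b e T) {N : ℕ} (hN : ∀ v, M.bits v < N)
    (hcard : k * Real.log (2 * N) < ((k : ℝ) ^ k)⁻¹ * T.card / 4) :
    ∃ T' : Finset (Fin m), ((k : ℝ) ^ k)⁻¹ * T.card / 4 ≤ T'.card ∧ Spreads H b (e + 1) T' := by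
  classical
  have hk : 0 < k := e.pos
  have hk1 : (1 : ℝ) ≤ (k : ℝ) ^ k := one_le_pow₀ (by exact_mod_cast hk)
  have : Nonempty (Fin k) := ⟨e⟩
  -- `U` indexes `2 * N` colourings of `T`, and `f x u` is the colour of `x` in colouring `u`. The
  -- relation `R f u` says that the bank can serve each bidder `j` by colouring `u j`, with that of
  -- `e` unlike all others.
  let U := Fin N × Bool
  let R : (T → U → Fin k) → (Fin k → U) → Prop := fun f u =>
    (∀ i, i ≠ e → u i ≠ u e) ∧ ∃ S ∈ H, ∀ j, (S (b j)).Nonempty ∧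
      ∀ x : T, ((j : ℕ) < e ∨ f x (u j) = j) → (x : Fin m) ∈ S (b j)
  have hR : ∀ f, ∃ u, R f u := by
    by_contra! hcon
    obtain ⟨f, hf⟩ := hcon
    let X : Fin k → U → Finset (Fin m) := fun j u =>
      (Finset.univ.filter fun x : T => (j : ℕ) < e ∨ f x u = j).map (Function.Embedding.subtype _)
    have hX : ∀ j u S, X j u ⊆ S ↔ ∀ x : T, ((j : ℕ) < e ∨ f x u = j) → (x : Fin m) ∈ S := by
      intro j u S
      simp only [X, Finset.subset_iff, Finset.mem_map, Finset.mem_filter, Finset.mem_univ,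
        true_and, Function.Embedding.subtype_apply]
      constructor
      · exact fun h x hx => h ⟨x, hx, rfl⟩
      · rintro h _ ⟨x, hx, rfl⟩
        exact h x hx
    obtain ⟨v, hv⟩ := hM.exists_le_bits hb e N
      -- Bidder `e` accepts colourings `(i, c i)`, the others `(i, !c i)`. Satisfying `c` would thus
      -- give the decoupled `u` excluded by `hf`. If `c i ≠ c' i`, colouring `(i, c i)` suits `e`
      -- under `c` and the others under `c'`, so `Spreads` serves the mixture.
      (fun c j => {A | ∃ u : U, (c u.1 = u.2 ↔ j = e) ∧ A = X j u}) (by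
        intro c S hS hsat
        have : ∀ j, ∃ u : U, (c u.1 = u.2 ↔ j = e) ∧ X j u ⊆ S (b j) := by
          intro j
          obtain ⟨-, A, ⟨u, hu, rfl⟩, hA⟩ := hsat j
          exact ⟨u, hu, hA⟩
        choose u hu hXu using this
        refine hf u ⟨fun i hi h => hi ((hu i).1 ?_), S, hS,
          fun j => ⟨(hsat j).1, (hX _ _ _).1 (hXu j)⟩⟩
        rw [h]
        exact (hu e).2 rfl) (by
        intro c c' hne
        obtain ⟨i, hi⟩ := Function.ne_iff.1 hne
        -- The colour `e` outside `T` is a dummy.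
        obtain ⟨S, hS, hmem⟩ := hT fun x => if hx : x ∈ T then f ⟨x, hx⟩ (i, c i) else e
        refine ⟨S, hS, fun j => ⟨(hmem j).1, X j (i, c i), ?_, (hX _ _ _).2 fun x hx => ?_⟩⟩
        · by_cases hj : j = e
          · subst hj
            rw [Function.update_self]
            exact ⟨_, by simp, rfl⟩
          · rw [Function.update_of_ne hj]
            exact ⟨_, by simp [hj, hi.symm], rfl⟩
        · refine (hmem j).2 x x.2 (hx.imp_right fun h => ?_)
          rw [dif_pos x.2]
          exact h)
    exact absurd (hN v) (not_lt.2 hv)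
  have hV : Real.log (Fintype.card (Fin k → U)) =
      k * Real.log (2 * N) := by
    rw [Fintype.card_fun, Fintype.card_prod, Fintype.card_fin, Fintype.card_fin,
      Fintype.card_bool]
    push_cast
    rw [Real.log_pow, mul_comm (N : ℝ)]
  obtain ⟨u, T', hT', hsh⟩ := exists_shatter_of_forall_exists (ι := Fin k)
    -- These labels give `x` to bidder `e` in its own colouring and colour `j` in all others: on the
    -- shattered set `e` receives everything while the remaining bidders still follow an arbitrary
    -- `g`.
    (fun (u : Fin k → U) (j : Fin k) => Finset.univ.filter fun l : U → Fin k =>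
      l (u e) = e ∧ ∀ i, i ≠ e → l (u i) = j)
    (p := ((k : ℝ) ^ k)⁻¹) (by positivity) (inv_le_one_of_one_le₀ hk1) R hR (by
      intro f u hfu j
      have h1 := card_le_card_filter_mul_pow u e j hfu.1
      rw [inv_mul_le_iff₀ (by positivity), mul_comm]
      exact_mod_cast h1) (by rw [hV, Fintype.card_coe]; exact hcard)
  rw [Fintype.card_coe] at hT'
  refine ⟨T'.map (Function.Embedding.subtype _), by rwa [Finset.card_map], fun g => ?_⟩
  obtain ⟨f, ⟨-, S, hS, hmem⟩, hfg⟩ := hsh fun x => g x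
  refine ⟨S, hS, fun j => ⟨(hmem j).1, fun x hx hj => ?_⟩⟩
  obtain ⟨y, hy, rfl⟩ := Finset.mem_map.1 hx
  have hfy := (Finset.mem_filter.1 (hfg y hy)).2
  refine (hmem j).2 y ?_
  by_cases hje : j = e
  · subst hje
    exact Or.inr hfy.1
  · rcases hj with hj | hj
    · left
      have : (j : ℕ) ≠ e := fun h => hje (Fin.ext h)
      omega
    · right
      rw [hfy.2 j hje]
      exact hj

theorem Spreads.exists_of_le {M : Mechanism n m (MultiMinded m)} {H : Set (Bundles n m)}
    (hM : IsMaximalIn M H) {b : Fin k → Fin n} (hb : Function.Injective b)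
    {T : Finset (Fin m)} (hT : Spreads H b 0 T) {N : ℕ} (hN : ∀ v, M.bits v < N)
    (hcard : k * Real.log (2 * N) < (((k : ℝ) ^ k)⁻¹ / 4) ^ k * T.card) {e : ℕ} (he : e ≤ k) :
    ∃ T' : Finset (Fin m), (((k : ℝ) ^ k)⁻¹ / 4) ^ e * T.card ≤ T'.card ∧ Spreads H b e T' := by
  induction e with
  | zero => exact ⟨T, by simp, hT⟩
  | succ e ih =>
    obtain ⟨T₁, hT₁, hs⟩ := ih (by omega)
    have hk1 : (1 : ℝ) ≤ (k : ℝ) ^ k := one_le_pow₀ (by exact_mod_cast (by omega : 1 ≤ k))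
    have hinv := inv_le_one_of_one_le₀ hk1
    set p : ℝ := ((k : ℝ) ^ k)⁻¹ with hp
    have hp0 : 0 ≤ p := by positivity
    have h1 : (p / 4) ^ (e + 1) * T.card ≤ p * T₁.card / 4 := by
      calc (p / 4) ^ (e + 1) * T.card = p / 4 * ((p / 4) ^ e * T.card) := by ring
        _ ≤ p / 4 * T₁.card := by gcongr
        _ = p * T₁.card / 4 := by ring
    -- The size condition for the last round covers all earlier ones.
    have h2 : (p / 4) ^ k * T.card ≤ (p / 4) ^ (e + 1) * T.card :=
      mul_le_mul_of_nonneg_right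
        (pow_le_pow_of_le_one (by positivity) (by linarith) he) (Nat.cast_nonneg _)
    obtain ⟨T₂, hT₂, hs₂⟩ := Spreads.exists_succ hM hb (e := ⟨e, by omega⟩) hs hN
      (by linarith)
    exact ⟨T₂, h1.trans hT₂, hs₂⟩

/-! ### The initial split forced by the approximation ratio -/

/-- If `t` bidders want the pieces of a partition, at least `t / α ≥ k` are satisfied. There are at
most `t ^ k` choices of `k` such bidders, and prescribing one owner for an item has density `1 / t`,
so the shattering count applies. -/
theorem exists_spreads_zero {M : Mechanism n m (MultiMinded m)} {H : Set (Bundles n m)}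
    (hM : IsMaximalIn M H) {α : ℝ} (hα : M.HasApproxRatio α) {t : ℕ} (ht : 0 < t) (htn : t ≤ n)
    (htm : t ≤ m) (hk : 0 < k) (hα0 : 0 < α) (hkt : k * α ≤ t)
    (hlog : k * Real.log t < (m - t) / (4 * t)) :
    ∃ (b : Fin k → Fin n) (T : Finset (Fin m)), Function.Injective b ∧
      ((m : ℝ) - t) / (4 * t) ≤ T.card ∧ Spreads H b 0 T := by
  classical
  let I : Fin t → Fin n := Fin.castLE htn
  have hI : Function.Injective I := Fin.castLE_injective htn
  -- One reserved item per bidder keeps every piece nonempty, however the remaining items `Y` are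
  -- split.
  let r : Fin t → Fin m := Fin.castLE htm
  have hr : Function.Injective r := Fin.castLE_injective htm
  let Y := {x : Fin m // x ∉ Finset.univ.map ⟨r, hr⟩}
  have hY : (Fintype.card Y : ℝ) = m - t := by
    rw [Fintype.card_subtype_compl, Fintype.card_fin, Fintype.card_coe, Finset.card_map,
      Finset.card_univ, Fintype.card_fin, Nat.cast_sub htm]
  let A : (Y → Fin t) → Fin t → Finset (Fin m) := fun f i =>
    insert (r i) ((Finset.univ.filter fun x => f x = i).map (Function.Embedding.subtype _))
  have hAdisj : ∀ f i i', i ≠ i' → Disjoint (A f i) (A f i') := by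
    intro f i i' hne
    rw [Finset.disjoint_left]
    intro x hx hx'
    rcases Finset.mem_insert.1 hx with rfl | hx <;> rcases Finset.mem_insert.1 hx' with h | hx'
    · exact hne (hr h)
    · obtain ⟨y, -, hy⟩ := Finset.mem_map.1 hx'
      exact y.2 (Finset.mem_map.2 ⟨i, Finset.mem_univ _, hy.symm⟩)
    · obtain ⟨y, -, hy⟩ := Finset.mem_map.1 hx
      exact y.2 (Finset.mem_map.2 ⟨i', Finset.mem_univ _, (hy.trans h).symm⟩)
    · obtain ⟨y, hy, rfl⟩ := Finset.mem_map.1 hx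
      obtain ⟨y', hy', h⟩ := Finset.mem_map.1 hx'
      obtain rfl := Subtype.ext h
      exact hne ((Finset.mem_filter.1 hy).2.symm.trans (Finset.mem_filter.1 hy').2)
  let R : (Y → Fin t) → (Fin k → Fin t) → Prop := fun f b => Function.Injective b ∧
    ∃ S ∈ H, ∀ j, (S (I (b j))).Nonempty ∧ ∀ x : Y, f x = b j → (x : Fin m) ∈ S (I (b j))
  have hR : ∀ f, ∃ b, R f b := by
    intro f
    let 𝒜 : Fin t → Set (Finset (Fin m)) := fun i => {A f i}
    let S₀ : Bundles n m := fun i' => Finset.univ.filter fun x => ∃ i, I i = i' ∧ x ∈ A f i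
    have hS₀ : IsAllocation S₀ := by
      intro i i' hne
      rw [Finset.disjoint_left]
      intro x hx hx'
      obtain ⟨i, rfl, hxi⟩ := (Finset.mem_filter.1 hx).2
      obtain ⟨i', rfl, hxi'⟩ := (Finset.mem_filter.1 hx').2
      exact Finset.disjoint_left.1 (hAdisj f i i' fun h => hne (congrArg I h)) hxi hxi'
    have hsat : Satisfies I 𝒜 S₀ := by
      intro i
      have hsub : A f i ⊆ S₀ (I i) := fun x hx =>
        Finset.mem_filter.2 ⟨Finset.mem_univ _, i, rfl, hx⟩
      exact ⟨⟨r i, hsub (Finset.mem_insert_self _ _)⟩, A f i, rfl, hsub⟩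
    have h1 := (satisfies_iff_le_welfare hI 𝒜 S₀).1 hsat
    have h2 := hα (bids I 𝒜) S₀ hS₀
    set O := M.bundles (bids I 𝒜) with hO
    rw [welfare_bids hI 𝒜 O] at h2
    set W : Finset (Fin t) :=
      Finset.univ.filter fun i => (wants (𝒜 i) : Valuation m) (O (I i)) = 1 with hW
    have h3 : ∑ i, (wants (𝒜 i) : Valuation m) (O (I i)) = W.card := by
      rw [hW, Finset.card_filter, Nat.cast_sum]
      refine Finset.sum_congr rfl fun i _ => ?_
      split_ifs with h
      · rw [h, Nat.cast_one]
      · rw [Nat.cast_zero]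
        exact ((wants (𝒜 i)).2 _).resolve_right h
    have h4 : (k : ℝ) ≤ W.card := by
      rw [h3] at h2
      refine le_trans ?_ h2
      rw [one_div, inv_mul_eq_div, le_div_iff₀ hα0]
      exact hkt.trans h1
    have h5 : k ≤ W.card := by exact_mod_cast h4
    let b : Fin k → Fin t := fun j => (W.equivFin.symm (Fin.castLE h5 j) : W)
    refine ⟨b, ?_, O, (hM _).1, fun j => ?_⟩
    · intro j j' h
      exact Fin.castLE_injective h5 (W.equivFin.symm.injective (Subtype.ext h))
    · have hbj : b j ∈ W := (W.equivFin.symm (Fin.castLE h5 j)).2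
      obtain ⟨hne, _, rfl, hsub⟩ := wants_eq_one_iff.1 (Finset.mem_filter.1 hbj).2
      refine ⟨hne, fun x hx => hsub (Finset.mem_insert_of_mem (Finset.mem_map.2 ⟨x, ?_, rfl⟩))⟩
      exact Finset.mem_filter.2 ⟨Finset.mem_univ _, hx⟩
  have ht1 : (1 : ℝ) ≤ t := by exact_mod_cast ht
  have hdiv : (t : ℝ)⁻¹ * Fintype.card Y / 4 = (m - t) / (4 * t) := by
    rw [hY]
    field_simp
  have : Nonempty (Fin t) := ⟨⟨0, ht⟩⟩
  obtain ⟨b, T, hT, hsh⟩ := exists_shatter_of_forall_exists (ι := Fin k)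
    (fun (b : Fin k → Fin t) j => {b j}) (p := (t : ℝ)⁻¹) (by positivity)
    (inv_le_one_of_one_le₀ ht1) R hR (fun _ b _ j => by
      rw [Fintype.card_fin, Finset.card_singleton, Nat.cast_one,
        inv_mul_cancel₀ (by positivity)]) (by
      rw [hdiv, Fintype.card_fun, Fintype.card_fin, Fintype.card_fin, Nat.cast_pow, Real.log_pow]
      exact hlog)
  rw [hdiv] at hT
  obtain ⟨-, ⟨hb, -⟩, -⟩ := hsh fun _ => ⟨0, hk⟩
  refine ⟨I ∘ b, T.map (Function.Embedding.subtype _), hI.comp hb, by rwa [Finset.card_map],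
    fun g => ?_⟩
  obtain ⟨f, ⟨-, S, hS, hmem⟩, hfg⟩ := hsh fun x => g x
  refine ⟨S, hS, fun j => ⟨(hmem j).1, fun x hx hj => ?_⟩⟩
  obtain ⟨y, hy, rfl⟩ := Finset.mem_map.1 hx
  refine (hmem j).2 y ?_
  rw [← hj.resolve_left (Nat.not_lt_zero _)]
  exact Finset.mem_singleton.1 (hfg y hy)

/-! ### Choice of parameters and conclusion -/

/-- The lower bound for explicit parameters. -/
theorem exists_le_bits_of_parameters {d : ℕ} {M : Mechanism n m (MultiMinded m)}
    (hM : M.IsVCGBased d) {α : ℝ} (hα : M.HasApproxRatio α) (hα0 : 0 < α) {t N : ℕ} (ht : 0 < t) (htn : t ≤ n) (htm : t ≤ m)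
    (hk : d < k) (hkt : k * α ≤ t) (hlog : k * Real.log t < (m - t) / (4 * t)) (hN0 : 0 < N)
    (hN : k * Real.log (2 * N) < (((k : ℝ) ^ k)⁻¹ / 4) ^ k * ((m - t) / (4 * t))) :
    ∃ v, N ≤ M.bits v := by
  obtain ⟨H, hH, hmax⟩ := hM
  have hmax : IsMaximalIn M H := hmax
  by_contra! hlt
  obtain ⟨b, T, hb, hT, hs⟩ := exists_spreads_zero hmax hα ht htn htm (by omega) hα0 hkt hlog
  have hcard := hN.trans_le (mul_le_mul_of_nonneg_left hT (by positivity))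
  obtain ⟨T', hT', hs'⟩ := hs.exists_of_le hmax hb hlt hcard le_rfl
  rw [hs'.eq_empty hH hk hb, Finset.card_empty, Nat.cast_zero] at hT'
  have : 0 ≤ Real.log (2 * N) := Real.log_nonneg (by
    have : (1 : ℝ) ≤ N := by exact_mod_cast hN0
    linarith)
  have : 0 ≤ k * Real.log (2 * N) := by positivity
  linarith

/-- No mechanism can have an approximation ratio below `1` relative to a single bidder. -/
theorem one_le_of_hasApproxRatio {M : Mechanism n m (MultiMinded m)} {α : ℝ}
    (hα : M.HasApproxRatio α) (hα0 : 0 < α) (hn : 0 < n) (hm : 0 < m) : 1 ≤ α := by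
  classical
  have : Nonempty (Fin m) := ⟨⟨0, hm⟩⟩
  let b : Fin 1 → Fin n := fun _ => ⟨0, hn⟩
  have hb : Function.Injective b := Function.injective_of_subsingleton b
  let S₀ : Bundles n m := fun i => if i = ⟨0, hn⟩ then Finset.univ else ∅
  have hS₀ : IsAllocation S₀ := by
    intro i i' hne
    by_cases hi : i = ⟨0, hn⟩
    · have hi' : i' ≠ ⟨0, hn⟩ := fun h => hne (hi.trans h.symm)
      simp [S₀, hi']
    · simp [S₀, hi]
  let 𝒜 : Fin 1 → Set (Finset (Fin m)) := fun _ => {Finset.univ}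
  have h1 := (satisfies_iff_le_welfare hb 𝒜 S₀).1
    fun j => ⟨by simp [S₀, b], Finset.univ, rfl, by simp [S₀, b]⟩
  have h2 := hα (bids b 𝒜) S₀ hS₀
  rw [welfare_bids hb 𝒜 (M.bundles _), Fin.sum_univ_one] at h2
  have h3 := h2.trans (MultiMinded.le_one _ _)
  rw [one_div, inv_mul_le_iff₀ hα0, mul_one] at h3
  simpa using h1.trans h3

theorem log_two_mul_ceil_exp_le {y : ℝ} (hy : 0 ≤ y) :
    Real.log (2 * ⌈Real.exp y⌉₊) ≤ 3 + y := by
  have hexp : 0 < Real.exp y := Real.exp_pos _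
  have hN0 : (0 : ℝ) < ⌈Real.exp y⌉₊ := hexp.trans_le (Nat.le_ceil _)
  have h1 : (⌈Real.exp y⌉₊ : ℝ) ≤ 2 * Real.exp y := by
    have := (Nat.ceil_lt_add_one hexp.le).le
    have := Real.add_one_le_exp y
    linarith
  have h2 : (4 : ℝ) ≤ Real.exp 3 := by
    have := Real.add_one_le_exp (3 : ℝ)
    linarith
  rw [Real.log_le_iff_le_exp (by positivity), Real.exp_add]
  have := mul_le_mul_of_nonneg_right h2 hexp.le
  linarith

/-- In terms of `z = x ^ (ε / 4)`, `t` exceeds `x ^ (1 - ε)` by a factor of at least `z`, and `(x -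
t) / (4 * t)` has order `z ^ 3`, which beats both `log t` and the logarithm `z ^ 2` of the target.
-/
theorem eventually_parameters {k c ε : ℝ} (hk0 : 0 < k) (hc0 : 0 < c) (hε : 0 < ε) (hε1 : ε ≤ 1) :
    ∀ᶠ x : ℝ in Filter.atTop, ∃ t : ℕ, t = ⌈x ^ (1 - 3 * ε / 4)⌉₊ ∧ (0 : ℝ) < t ∧ (t : ℝ) ≤ x ∧
      k * x ^ (1 - ε) ≤ t ∧ k * Real.log t < (x - t) / (4 * t) ∧
      k * Real.log (2 * ⌈Real.exp (x ^ (ε / 2))⌉₊) < c * ((x - t) / (4 * t)) := by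
  have hlim : Filter.Tendsto (fun x : ℝ => x ^ (ε / 4)) Filter.atTop Filter.atTop :=
    tendsto_rpow_atTop (by positivity)
  filter_upwards [hlim.eventually_ge_atTop 4, hlim.eventually_ge_atTop k,
    hlim.eventually_gt_atTop (64 * k / c), hlim.eventually_gt_atTop (64 * k / ε),
    Filter.eventually_gt_atTop 1] with x hz4 hzk hzc hzε hx1
  have hx0 : 0 < x := by linarith
  set z : ℝ := x ^ (ε / 4) with hz
  have hz2 : x ^ (ε / 2) = z ^ 2 := by
    rw [hz, ← Real.rpow_natCast, ← Real.rpow_mul hx0.le]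
    congr 1
    push_cast
    ring
  have hz3 : x ^ (3 * ε / 4) = z ^ 3 := by
    rw [hz, ← Real.rpow_natCast, ← Real.rpow_mul hx0.le]
    congr 1
    push_cast
    ring
  set w : ℝ := x ^ (1 - 3 * ε / 4) with hw
  have hw1 : 1 ≤ w := Real.one_le_rpow hx1.le (by linarith)
  have hxw : x = w * z ^ 3 := by
    rw [hw, ← hz3, ← Real.rpow_add hx0, sub_add_cancel, Real.rpow_one]
  have hαw : x ^ (1 - ε) * z = w := by
    rw [hw, hz, ← Real.rpow_add hx0]
    congr 1
    ring
  have hz3' : 64 ≤ z ^ 3 := by 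
    have := pow_le_pow_left₀ (by norm_num) hz4 3
    norm_num at this
    linarith
  have hw64 : w * 64 ≤ w * z ^ 3 := by gcongr
  set t : ℕ := ⌈w⌉₊ with ht
  have hwt : w ≤ t := Nat.le_ceil w
  have htw : (t : ℝ) ≤ 2 * w := by
    have := (Nat.ceil_lt_add_one (by linarith : 0 ≤ w)).le
    linarith
  have ht0 : (0 : ℝ) < t := by linarith
  have htx : (t : ℝ) ≤ x := by linarith
  have hratio : z ^ 3 / 16 ≤ (x - t) / (4 * t) := by
    rw [div_le_div_iff₀ (by norm_num) (by positivity)]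
    have : z ^ 3 * t ≤ z ^ 3 * (2 * w) := by gcongr
    linarith
  have hlogt : k * Real.log t < (x - t) / (4 * t) := by
    have h1 : Real.log t ≤ z / (ε / 4) :=
      (Real.log_le_log ht0 htx).trans (Real.log_le_rpow_div hx0.le (by positivity))
    refine lt_of_lt_of_le ?_ hratio
    calc k * Real.log t ≤ k * (z / (ε / 4)) := by gcongr
      _ = 64 * k / ε * z / 16 := by field_simp; norm_num
      _ < z * z / 16 := by gcongr
      _ ≤ z ^ 3 / 16 := by
        have : z ^ 2 ≤ z ^ 3 := pow_le_pow_right₀ (by linarith) (by norm_num)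
        linarith
  have hlogN : k * Real.log (2 * ⌈Real.exp (x ^ (ε / 2))⌉₊) < c * ((x - t) / (4 * t)) := by
    rw [hz2]
    calc k * Real.log (2 * ⌈Real.exp (z ^ 2)⌉₊) ≤ k * (3 + z ^ 2) := by
          gcongr
          exact log_two_mul_ceil_exp_le (sq_nonneg z)
      _ ≤ k * (4 * z ^ 2) := by
        have : 1 ≤ z ^ 2 := one_le_pow₀ (by linarith)
        gcongr
        linarith
      _ = c * (64 * k / c * z ^ 2 / 16) := by field_simp; norm_num
      _ < c * (z * z ^ 2 / 16) := by gcongr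
      _ = c * (z ^ 3 / 16) := by ring
      _ ≤ c * ((x - t) / (4 * t)) := by gcongr
  have hkt : k * x ^ (1 - ε) ≤ t := by
    refine le_trans ?_ hwt
    rw [← hαw, mul_comm]
    gcongr
  exact ⟨t, rfl, ht0, htx, hkt, hlogt, hlogN⟩

end CombAuction

theorem mainTheorem6 (d : ℕ) (hd : 1 ≤ d) (ε : ℝ) (hε : 0 < ε) :
    ∃ m₀ : ℕ, ∀ m : ℕ, m₀ ≤ m → ∀ n : ℕ, (m : ℝ) ^ (1 - 3 * ε / 4) ≤ (n : ℝ) →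
      ∀ M : CombAuction.Mechanism n m (CombAuction.MultiMinded m),
        CombAuction.Mechanism.IsVCGBased d M →
        CombAuction.Mechanism.HasApproxRatio M ((m : ℝ) ^ (1 - ε)) →
        ∃ v : Fin n → CombAuction.MultiMinded m,
          Real.exp ((m : ℝ) ^ (ε / 2)) ≤ (CombAuction.Protocol.bits M v : ℝ) := by
  set k : ℕ := d + 1 with hk
  have hk0 : (0 : ℝ) < k := by rw [hk]; positivity
  by_cases hε1 : ε ≤ 1
  · obtain ⟨m₀, hm₀⟩ := Filter.eventually_atTop.1 (tendsto_natCast_atTop_atTop.eventually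
      (CombAuction.eventually_parameters (c := (((k : ℝ) ^ k)⁻¹ / 4) ^ k) hk0 (by positivity)
        hε hε1))
    refine ⟨max m₀ 1, fun m hm n hn M hM hα => ?_⟩
    obtain ⟨t, rfl, ht0, htm, hkt, hlogt, hlogN⟩ := hm₀ m (le_of_max_le_left hm)
    have hm0 : (0 : ℝ) < m := by exact_mod_cast le_of_max_le_right hm
    obtain ⟨v, hv⟩ := CombAuction.exists_le_bits_of_parameters hM hα (by positivity)
      (Nat.cast_pos.1 ht0) (Nat.ceil_le.2 hn) (Nat.cast_le.1 htm) (Nat.lt_succ_self d) hkt hlogt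
      (Nat.ceil_pos.2 (Real.exp_pos _)) hlogN
    exact ⟨v, (Nat.le_ceil _).trans (Nat.cast_le.2 hv)⟩
  -- For `ε > 1` and `m ≥ 2` the ratio `m ^ (1 - ε)` is below `1`, which no mechanism attains.
  · refine ⟨2, fun m hm n hn M _ hα => ?_⟩
    have hm1 : (1 : ℝ) < m := by exact_mod_cast hm
    have hm0 : (0 : ℝ) < m := by linarith
    have hn0 : (0 : ℝ) < n := lt_of_lt_of_le (by positivity) hn
    exact absurd (CombAuction.one_le_of_hasApproxRatio hα (by positivity) (Nat.cast_pos.1 hn0)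
      (by omega)) (not_le.2 (Real.rpow_lt_one_of_one_lt_of_neg hm1 (by linarith)))
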